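/- Let $K\ge 2$, $\sigma^2>0$ and $\delta\in(0,1)$. A bandit instance consists of $K$ Gaussian arms $\mathcal N(\mu_i,\sigma^2)$, $i\in[K]$, with known variance $\sigma^2$ and unimodal mean vector $\mu\in\mathcal S$, i.e. $\mu$ has a unique maximizer $i^\star(\mu)$, $\mu_j\le\mu_{j+1}$ for $j<i^\star(\mu)$ and $\mu_j\ge\mu_{j+1}$ for $i^\star(\mu)\le j<K$. In each round $t\ge1$ an arm $I_t$ is chosen by a sampling rule (possibly randomized) on the basis of $(I_s,X_s)_{s<t}$, and $X_t\sim\mathcal N(\mu_{I_t},\sigma^2)$ is observed, conditionally on the past and $I_t$. Let $N_i(t)=\sum_{s<t}\mathbf 1\{I_s=i\}$ and $\hat\mu_i(t)=N_i(t)^{-1}\sum_{s<t}\mathbf 1\{I_s=i\}X_s$, let $d(x,\theta)=(x-\theta)^2/(2\sigma^2)$ be the Kullback–Leibler divergence between $\mathcal N(x,\sigma^2)$ and $\mathcal N(\theta,\sigma^2)$, let $\mathcal N(i)=\{i-1,i+1\}\cap[K]$ be the set of neighbours of arm $i$, and for $j\in\mathcal N(i)$ let \[ W_t(i,j)=\inf_{\theta_j\ge\theta_i}\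 \sum_{k\in\{i,j\}}N_k(t)\,d(\hat\mu_k(t),\theta_k) \] (a term with $N_k(t)=0$ is $0$). Let the recommended arm be any \[ \hat\imath_t\in\operatorname{argmax}_{i\in[K]}\min_{j\in\mathcal N(i)}W_t(i,j), \] and for a threshold $c$ let the local GLR stopping rule be \[ \tau_\delta=\inf\Big\{t\ge 2:\ \min_{j\in\mathcal N(\hat\imath_t)}W_t(\hat\imath_t,j)\ge c(t-1,\delta)\Big\}. \] For $x\in\mathbb R$ let \[ \mathcal C_G(x)=\min_{\lambda\in(1/2,1]}\frac{g_G(\lambda)+x}{\lambda},\qquad g_G(\lambda)=2\lambda-2\lambda\log(4\lambda)+2\log\zeta(2\lambda)-\tfrac12\log(1-\lambda), \] where $\zeta$ is the Riemann zeta function and $g_G(1)=+\infty$. Take \[ c(t,\delta)=2\,\mathcal C_G\Big(\tfrac12\log\tfrac{K-1}{\delta}\Big)+4\log\log\frac{e^4t}{2},\qquad t\ge1. \] Then, for any sampling rule, the resulting algorithm is $\delta$-correct: for every unimodal mean vector $\mu\in\mathcal S$, \[ \mathbb P_\mu\big(\tau_\delta<\infty,\ \hat\imath_{\tau_\delta}\ne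 i^\star(\mu)\big)\le\delta . \] Moreover $\mathcal C_G(x)\approx x+\ln x$ in the sense that, as $x\to\infty$, $\mathcal C_G(x)\sim x+\ln x$ and $\mathcal C_G(x)-x=\Theta(\ln x)$. -/

import Mathlib

open MeasureTheory ProbabilityTheory
open scoped NNReal ENNReal

namespace UnimodalBandit

noncomputable section

/-! ### Unimodal mean vectors -/

/-- The set of arms with maximal mean, `argmax_i μ i`. -/
def bestArms {K : ℕ} (μ : Fin K → ℝ) : Set (Fin K) :=
  {i | ∀ j, μ j ≤ μ i}

/-- Unimodal instances: the maximum is attained at a unique arm `i`, the means are nondecreasing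
up to `i` and nonincreasing from `i` on. -/
def unimodal (K : ℕ) : Set (Fin K → ℝ) :=
  {μ | ∃ i, bestArms μ = {i} ∧
    (∀ j k : Fin K, (k : ℕ) = j + 1 → j < i → μ j ≤ μ k) ∧
    (∀ j k : Fin K, (k : ℕ) = j + 1 → i ≤ j → μ k ≤ μ j)}

/-- The neighbouring arms `i - 1` and `i + 1` of arm `i` (those that exist). -/
def neighbors {K : ℕ} (i : Fin K) : Set (Fin K) :=
  {j | (j : ℕ) = i + 1 ∨ (i : ℕ) = j + 1}

/-! ### Algorithms and their interaction with the arms -/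

/-- The first `n` pulled arms and observations. Before time `t` the agent has seen `n = t - 1` of
them. -/
abbrev History (K n : ℕ) : Type := Fin n → Fin K × ℝ

/-- A (possibly randomized) sampling rule: `rule n h` is the law of the arm pulled in round `n + 1`
when the history of the first `n` rounds is `h`. A deterministic rule, whose next arm is a
measurable function of the history, corresponds to `Kernel.deterministic`. -/
structure SamplingRule (K : ℕ) where
  rule : ∀ n, Kernel (History K n) (Fin K)
  isMarkov : ∀ n, IsMarkovKernel (rule n)

/-- A strategy: a sampling rule, a stopping rule and a recommendation rule. At time `t = n + 1` the
agent stops if the history of the first `n` rounds belongs to `stopSet n`, and then recommends the arm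
`recommend n h`. -/
structure Algorithm (K : ℕ) where
  sampling : SamplingRule K
  stopSet : ∀ n, Set (History K n)
  recommend : ∀ n, History K n → Fin K

variable {K : ℕ} {Ω : Type*}

/-- The history of the first `n` rounds; `I n` and `X n` are the arm and the observation of round
`n + 1`. -/
def hist (I : ℕ → Ω → Fin K) (X : ℕ → Ω → ℝ) (n : ℕ) (ω : Ω) : History K n :=
  fun s => (I s ω, X s ω)

/-- Under `P`, the arms `I` and observations `X` result from playing the sampling rule `π` against
the Gaussian arms `𝓝(μ i, v)`: given the past, the next arm has the law prescribed by `π`, and given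
the past and the pulled arm `i`, the observation has law `𝓝(μ i, v)`. -/
structure IsInteraction [MeasurableSpace Ω] (π : SamplingRule K) (μ : Fin K → ℝ) (v : ℝ≥0)
    (P : Measure Ω) (I : ℕ → Ω → Fin K) (X : ℕ → Ω → ℝ) : Prop where
  arm_law : ∀ n, HasCondDistrib (I n) (hist I X n) (π.rule n) P
  obs_law : ∀ n, HasCondDistrib (X n) (fun ω => (hist I X n ω, I n ω))
    (Kernel.prodMkLeft (History K n) (Kernel.ofFunOfCountable fun i => gaussianReal (μ i) v)) P

/-- The stopping time `τ`: the first time `t = n + 1` at which the stopping rule is met. -/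
def stoppingTime (A : Algorithm K) (I : ℕ → Ω → Fin K) (X : ℕ → Ω → ℝ) (ω : Ω) : ℕ∞ :=
  ⨅ (n : ℕ) (_ : hist I X n ω ∈ A.stopSet n), ((n + 1 : ℕ) : ℕ∞)

/-- The event that the algorithm stops and recommends an arm which is not the best one. -/
def errorEvent (A : Algorithm K) (μ : Fin K → ℝ) (I : ℕ → Ω → Fin K) (X : ℕ → Ω → ℝ) : Set Ω :=
  {ω | ∃ n : ℕ, stoppingTime A I X ω = ((n + 1 : ℕ) : ℕ∞) ∧
    A.recommend n (hist I X n ω) ∉ bestArms μ}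

/-- `δ`-correctness on Gaussian arms with known variance `v` and unimodal mean vector. -/
def IsDeltaCorrect.{u} (A : Algorithm K) (v : ℝ≥0) (δ : ℝ) : Prop :=
  ∀ μ ∈ unimodal K, ∀ (Ω : Type u) [MeasurableSpace Ω] (P : Measure Ω) [IsProbabilityMeasure P]
    (I : ℕ → Ω → Fin K) (X : ℕ → Ω → ℝ), IsInteraction A.sampling μ v P I X →
      P (errorEvent A μ I X) ≤ ENNReal.ofReal δ

/-! ### The local GLR stopping rule -/

/-- Kullback-Leibler divergence between the Gaussian laws with variance `v` and means `x`, `θ`. -/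
def kl (v : ℝ≥0) (x θ : ℝ) : ℝ :=
  (InformationTheory.klDiv (gaussianReal x v) (gaussianReal θ v)).toReal

/-- The number of pulls of arm `i`. -/
def count {n : ℕ} (h : History K n) (i : Fin K) : ℕ :=
  (Finset.univ.filter fun s => (h s).1 = i).card

/-- The empirical mean of arm `i`. Its value for an arm that was never pulled is irrelevant below,
since it is always weighted by the number of pulls. -/
def empMean {n : ℕ} (h : History K n) (i : Fin K) : ℝ :=
  (∑ s ∈ Finset.univ.filter (fun s => (h s).1 = i), (h s).2) / count h i

/-- The empirical transportation cost `W(i, j)`, an infimum over all pairs `(θ_i, θ_j)` with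
`θ_i ≤ θ_j`. -/
def transportCost (v : ℝ≥0) {n : ℕ} (h : History K n) (i j : Fin K) : ℝ :=
  ⨅ θ : {θ : ℝ × ℝ // θ.1 ≤ θ.2},
    (count h i * kl v (empMean h i) θ.1.1 + count h j * kl v (empMean h j) θ.1.2)

/-- The minimal transportation cost of arm `i` to its neighbours. -/
def localCost (v : ℝ≥0) {n : ℕ} (h : History K n) (i : Fin K) : ℝ :=
  ⨅ j : neighbors i, transportCost v h i j

/-- A recommendation rule that picks, at every time, an arm maximizing the minimal transportation
cost to its neighbours (ties are broken arbitrarily). -/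
def IsLocalRecommendation (v : ℝ≥0) (ρ : ∀ n, History K n → Fin K) : Prop :=
  ∀ n (h : History K n) (i : Fin K), localCost v h i ≤ localCost v h (ρ n h)

/-- The sampling rule `π` with the recommendation rule `ρ` and the local GLR stopping rule, which
stops at time `t = n + 1` as soon as the minimal transportation cost of the recommended arm to its
neighbours is at least `c (t - 1) = c n`. At least one observation is required, as the thresholds
of interest are defined for `n ≥ 1` only. -/
def localGLR (v : ℝ≥0) (c : ℕ → ℝ) (π : SamplingRule K) (ρ : ∀ n, History K n → Fin K) :
    Algorithm K where
  sampling := π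
  stopSet n := {h | 1 ≤ n ∧ c n ≤ localCost v h (ρ n h)}
  recommend := ρ

/-! ### The threshold -/

/-- `g_G(l) = 2 l - 2 l log(4 l) + 2 log ζ(2 l) - log(1 - l) / 2` for `1/2 < l < 1`. -/
def gG (l : ℝ) : ℝ :=
  2 * l - 2 * l * Real.log (4 * l) + 2 * Real.log (riemannZeta (2 * l : ℝ)).re
    - 1 / 2 * Real.log (1 - l)

/-- `C_G(x) = min_{1/2 < l ≤ 1} (g_G(l) + x) / l`. The endpoint `l = 1`, where `g_G` is `+∞`, does
not contribute to the minimum and is left out. -/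
def CG (x : ℝ) : ℝ :=
  ⨅ l : Set.Ioo (1 / 2 : ℝ) 1, (gG l + x) / l

/-- The threshold `c(t, δ) = 2 C_G(log((K - 1) / δ) / 2) + 4 log log(e⁴ t / 2)`, for `t ≥ 1`. -/
def threshold (K : ℕ) (δ : ℝ) (t : ℕ) : ℝ :=
  2 * CG (1 / 2 * Real.log (((K : ℝ) - 1) / δ)) + 4 * Real.log (Real.log (Real.exp 4 * t / 2))

end

end UnimodalBandit

namespace UnimodalBandit

/-! A wrong recommendation `i` has a neighbour `j` on the side of the best arm with `μ i ≤ μ j`, so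
`(μ i, μ j)` competes in the infimum defining `W(i, j)`. Stopping therefore forces the
self-normalised deviations of arms `i` and `j` from their true means to exceed the threshold
together. Since `j` depends only on `i` and `μ`, a union bound over `K - 1` arms suffices.

For a fixed pair, the product of two Gaussian-mixture likelihood ratios is a martingale starting at
1 under every sampling rule, and Ville's inequality (`IsInteraction.mul_measure_exists_le`) bounds
by `δ / (K - 1)` the probability that it ever reaches `(K - 1) / δ`. The mixture is chosen in
`le_evidence_prior` so that a large deviation makes the product large: its logarithmic cost is
`mixturePrice l` plus an iterated logarithm, and optimising over `l` produces `CG`.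

For the asymptotics, `x / l - log (1 - l) / 2` is nearly minimal for `1 - l` of order `1 / x`, which
costs a logarithm of `x`. -/

/-! ### Kullback–Leibler divergence of Gaussian laws with equal variance -/

lemma gaussianReal_eq_withDensity_gaussianReal {v : ℝ≥0} (hv : v ≠ 0) (x θ : ℝ) :
    gaussianReal x v = (gaussianReal θ v).withDensity
      (fun y => ENNReal.ofReal (Real.exp (((y - θ) ^ 2 - (y - x) ^ 2) / (2 * v)))) := by
  have hm : Measurable fun y : ℝ =>
      ENNReal.ofReal (Real.exp (((y - θ) ^ 2 - (y - x) ^ 2) / (2 * v))) := by fun_prop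
  rw [gaussianReal_of_var_ne_zero x hv, gaussianReal_of_var_ne_zero θ hv,
    ← withDensity_mul _ (measurable_gaussianPDF θ v) hm]
  congr 1
  ext y
  simp only [Pi.mul_apply, gaussianPDF, gaussianPDFReal]
  rw [← ENNReal.ofReal_mul (by positivity), mul_assoc (√_)⁻¹, ← Real.exp_add]
  congr 3
  ring

/-- With equal variances the log-likelihood ratio is affine in the observation, so only the mean
enters. -/
lemma kl_eq {v : ℝ≥0} (hv : v ≠ 0) (x θ : ℝ) : kl v x θ = (x - θ) ^ 2 / (2 * v) := by
  have hm : Measurable fun y : ℝ =>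
      ENNReal.ofReal (Real.exp (((y - θ) ^ 2 - (y - x) ^ 2) / (2 * v))) := by fun_prop
  have hd := gaussianReal_eq_withDensity_gaussianReal hv x θ
  have hac : gaussianReal x v ≪ gaussianReal θ v := by
    rw [hd]; exact withDensity_absolutelyContinuous _ _
  have hllr : llr (gaussianReal x v) (gaussianReal θ v) =ᵐ[gaussianReal x v]
      fun y => ((x - θ) / v) * y + (θ ^ 2 - x ^ 2) / (2 * v) := by
    have h := Measure.rnDeriv_withDensity (gaussianReal θ v) hm
    rw [← hd] at h
    filter_upwards [hac.ae_le h] with y hy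
    rw [llr, hy, ENNReal.toReal_ofReal (Real.exp_pos _).le, Real.log_exp]
    have : (v : ℝ) ≠ 0 := by exact_mod_cast hv
    field_simp
    ring
  have hint : Integrable (fun y : ℝ => y) (gaussianReal x v) :=
    (memLp_id_gaussianReal (μ := x) (v := v) 1).integrable (by simp)
  rw [kl, InformationTheory.toReal_klDiv_of_measure_eq hac (by simp), integral_congr_ae hllr,
    integral_add (hint.const_mul _) (integrable_const _), integral_const_mul,
    integral_id_gaussianReal]
  have : (v : ℝ) ≠ 0 := by exact_mod_cast hv
  simp only [integral_const, probReal_univ, one_smul]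
  field_simp
  ring

/-! ### Mixtures of likelihood ratios -/

/-- The likelihood ratio of `N` centred observations of variance `v` with sum `S`, for the mean shift
`v * y`, averaged over `y` with law `ρ`. -/
noncomputable def evidence (ρ : Measure ℝ) (v : ℝ≥0) (N : ℕ) (S : ℝ) : ℝ≥0∞ :=
  ∫⁻ y, ENNReal.ofReal (Real.exp (y * S - y ^ 2 * v * N / 2)) ∂ρ

lemma measurable_evidence (ρ : Measure ℝ) [SFinite ρ] (v : ℝ≥0) :
    Measurable fun p : ℕ × ℝ => evidence ρ v p.1 p.2 := by
  unfold evidence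
  refine Measurable.lintegral_prod_right' (f := fun q : (ℕ × ℝ) × ℝ =>
    ENNReal.ofReal (Real.exp (q.2 * q.1.2 - q.2 ^ 2 * v * q.1.1 / 2))) ?_
  have : Measurable fun q : (ℕ × ℝ) × ℝ => (q.1.1 : ℝ) :=
    measurable_from_top.comp (measurable_fst.comp measurable_fst)
  fun_prop

lemma evidence_zero (ρ : Measure ℝ) (v : ℝ≥0) : evidence ρ v 0 0 = ρ Set.univ := by
  simp [evidence]

lemma lintegral_exp_mul_gaussianReal (m : ℝ) (v : ℝ≥0) (y : ℝ) :
    ∫⁻ x, ENNReal.ofReal (Real.exp (y * x)) ∂gaussianReal m v =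
      ENNReal.ofReal (Real.exp (m * y + v * y ^ 2 / 2)) := by
  rw [← ofReal_integral_eq_lintegral_ofReal (integrable_exp_mul_gaussianReal y)
    (ae_of_all _ fun x => (Real.exp_pos _).le)]
  congr 1
  exact congrFun (mgf_id_gaussianReal (μ := m) (v := v)) y

/-- By Tonelli it suffices to fix `y`; the Gaussian moment generating function then cancels the
extra `y² v / 2`. -/
lemma lintegral_evidence_succ (ρ : Measure ℝ) [SFinite ρ] (v : ℝ≥0) (N : ℕ) (S m : ℝ) :
    ∫⁻ x, evidence ρ v (N + 1) (S + (x - m)) ∂gaussianReal m v = evidence ρ v N S := by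
  unfold evidence
  rw [lintegral_lintegral_swap (by fun_prop)]
  refine lintegral_congr fun y => ?_
  have h : ∀ x : ℝ, ENNReal.ofReal
      (Real.exp (y * (S + (x - m)) - y ^ 2 * v * ((N + 1 : ℕ) : ℝ) / 2)) =
      ENNReal.ofReal (Real.exp (y * (S - m) - y ^ 2 * v * ((N + 1 : ℕ) : ℝ) / 2)) *
        ENNReal.ofReal (Real.exp (y * x)) := by
    intro x
    rw [← ENNReal.ofReal_mul (Real.exp_pos _).le, ← Real.exp_add]
    congr 2
    ring
  simp_rw [h]
  rw [lintegral_const_mul _ (by fun_prop), lintegral_exp_mul_gaussianReal,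
    ← ENNReal.ofReal_mul (Real.exp_pos _).le, ← Real.exp_add]
  congr 2
  push_cast
  ring

lemma evidence_gaussianReal {τ : ℝ≥0} (hτ : τ ≠ 0) (v : ℝ≥0) (N : ℕ) (S : ℝ) :
    evidence (gaussianReal 0 τ) v N S = ENNReal.ofReal
      ((√(1 + τ * v * N))⁻¹ * Real.exp (τ / (1 + τ * v * N) * S ^ 2 / 2)) := by
  -- Completing the square: `w` is the posterior variance of `y` and `w * S` its posterior mean.
  set w : ℝ≥0 := τ / (1 + τ * v * N) with hw
  have hw0 : w ≠ 0 := by positivity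
  have hwr : (w : ℝ) = τ / (1 + τ * v * N) := by simp [hw]
  have hτ' : (0 : ℝ) < τ := by positivity
  have hA : (0 : ℝ) < 1 + τ * v * N := by positivity
  rw [evidence, gaussianReal_of_var_ne_zero 0 hτ,
    lintegral_withDensity_eq_lintegral_mul _ (measurable_gaussianPDF 0 τ) (by fun_prop)]
  have h : ∀ y : ℝ, (gaussianPDF 0 τ * fun y =>
      ENNReal.ofReal (Real.exp (y * S - y ^ 2 * v * N / 2))) y =
      ENNReal.ofReal ((√(1 + τ * v * N))⁻¹ * Real.exp (τ / (1 + τ * v * N) * S ^ 2 / 2)) *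
        gaussianPDF (w * S) w y := by
    intro y
    simp only [Pi.mul_apply, gaussianPDF, gaussianPDFReal]
    rw [← ENNReal.ofReal_mul (by positivity), ← ENNReal.ofReal_mul (by positivity)]
    congr 1
    have hs : (√(2 * Real.pi * τ))⁻¹ = (√(1 + τ * v * N))⁻¹ * (√(2 * Real.pi * w))⁻¹ := by
      rw [← mul_inv, ← Real.sqrt_mul hA.le]
      congr 2
      rw [hwr]
      field_simp
    rw [hs, mul_assoc (_ * _), ← Real.exp_add, mul_mul_mul_comm, ← Real.exp_add]
    congr 2
    rw [hwr]
    field_simp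
    ring
  rw [lintegral_congr h, lintegral_const_mul _ (measurable_gaussianPDF _ _),
    lintegral_gaussianPDF_eq_one _ hw0, mul_one]

variable {K : ℕ} {Ω : Type*}

/-! ### Nonnegative supermartingales of the interaction -/

/-- The history `h` extended by one round. -/
def extend {n : ℕ} (h : History K n) (p : Fin K × ℝ) : History K (n + 1) :=
  Fin.snoc (α := fun _ => Fin K × ℝ) h p

lemma hist_succ (I : ℕ → Ω → Fin K) (X : ℕ → Ω → ℝ) (n : ℕ) (ω : Ω) :
    hist I X (n + 1) ω = extend (hist I X n ω) (I n ω, X n ω) := by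
  funext s
  refine Fin.lastCases ?_ (fun s => ?_) s
  · simp [hist, extend]
  · simp [hist, extend]

lemma measurable_extend {n : ℕ} :
    Measurable fun q : History K n × (Fin K × ℝ) => extend q.1 q.2 := by
  refine measurable_pi_iff.2 fun s => ?_
  refine Fin.lastCases ?_ (fun s => ?_) s
  · simpa [extend] using measurable_snd
  · have : Measurable fun q : History K n × (Fin K × ℝ) => q.1 s :=
      (measurable_pi_apply s).comp measurable_fst
    simpa [extend] using this

variable [MeasurableSpace Ω]

lemma IsInteraction.aemeasurable_hist {π : SamplingRule K} {μ : Fin K → ℝ} {v : ℝ≥0}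
    {P : Measure Ω} {I : ℕ → Ω → Fin K} {X : ℕ → Ω → ℝ} (h : IsInteraction π μ v P I X) (n : ℕ) :
    AEMeasurable (hist I X n) P :=
  (h.arm_law n).aemeasurable_fst

/-- Tower property for one round: the observation is integrated out first, then the arm. -/
lemma IsInteraction.lintegral_hist_succ {π : SamplingRule K} {μ : Fin K → ℝ} {v : ℝ≥0}
    {P : Measure Ω} [IsProbabilityMeasure P] {I : ℕ → Ω → Fin K} {X : ℕ → Ω → ℝ}
    (h : IsInteraction π μ v P I X) {n : ℕ} {f : History K (n + 1) → ℝ≥0∞} (hf : Measurable f) :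
    ∫⁻ ω, f (hist I X (n + 1) ω) ∂P = ∫⁻ ω, ∫⁻ a, ∫⁻ x, f (extend (hist I X n ω) (a, x))
      ∂gaussianReal (μ a) v ∂π.rule n (hist I X n ω) ∂P := by
  have := π.isMarkov n
  set κ : Kernel (Fin K) ℝ := Kernel.ofFunOfCountable fun i => gaussianReal (μ i) v with hκ
  have : IsMarkovKernel κ := ⟨fun a => by
    change IsProbabilityMeasure (gaussianReal (μ a) v)
    infer_instance⟩
  have hg : Measurable fun q : (History K n × Fin K) × ℝ => f (extend q.1.1 (q.1.2, q.2)) :=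
    hf.comp (measurable_extend.comp
      ((measurable_fst.comp measurable_fst).prodMk
        ((measurable_snd.comp measurable_fst).prodMk measurable_snd)))
  have hg' : Measurable fun q : History K n × Fin K =>
      ∫⁻ x, f (extend q.1 (q.2, x)) ∂gaussianReal (μ q.2) v :=
    Measurable.lintegral_kernel_prod_right (κ := Kernel.prodMkLeft (History K n) κ) hg
  have hg'' : Measurable fun h' : History K n => ∫⁻ a, ∫⁻ x, f (extend h' (a, x))
      ∂gaussianReal (μ a) v ∂π.rule n h' :=
    Measurable.lintegral_kernel_prod_right (κ := π.rule n) hg'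
  have h1 := (h.obs_law n).map_eq
  have h2 := (h.arm_law n).map_eq
  calc ∫⁻ ω, f (hist I X (n + 1) ω) ∂P
      = ∫⁻ q, f (extend q.1.1 (q.1.2, q.2))
          ∂(P.map fun ω => ((hist I X n ω, I n ω), X n ω)) := by
        rw [lintegral_map' hg.aemeasurable (h.obs_law n).aemeasurable]
        simp_rw [hist_succ]
    _ = ∫⁻ q, ∫⁻ x, f (extend q.1 (q.2, x)) ∂gaussianReal (μ q.2) v
          ∂(P.map fun ω => (hist I X n ω, I n ω)) := by
        rw [h1, Measure.lintegral_compProd hg]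
        rfl
    _ = _ := by
        rw [h2, Measure.lintegral_compProd hg',
          lintegral_map' hg''.aemeasurable (h.aemeasurable_hist n)]

open Classical in
/-- The process `M`, stopped when it reaches the level `c`. -/
noncomputable def stoppedAtLevel (M : ∀ n, History K n → ℝ≥0∞) (c : ℝ≥0∞) :
    ∀ n, History K n → ℝ≥0∞
  | 0, h => M 0 h
  | n + 1, h =>
    if c ≤ stoppedAtLevel M c n (fun s => h s.castSucc) then
      stoppedAtLevel M c n (fun s => h s.castSucc)
    else M (n + 1) h

/-- Ville's maximal inequality for a nonnegative supermartingale of the interaction. -/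
lemma IsInteraction.mul_measure_exists_le {π : SamplingRule K} {μ : Fin K → ℝ} {v : ℝ≥0}
    {P : Measure Ω} [IsProbabilityMeasure P] {I : ℕ → Ω → Fin K} {X : ℕ → Ω → ℝ}
    (h : IsInteraction π μ v P I X) {M : ∀ n, History K n → ℝ≥0∞} (hM : ∀ n, Measurable (M n))
    (hM0 : ∀ h, M 0 h ≤ 1)
    (hstep : ∀ n h a, ∫⁻ x, M (n + 1) (extend h (a, x)) ∂gaussianReal (μ a) v ≤ M n h)
    (c : ℝ≥0∞) : c * P {ω | ∃ n, c ≤ M n (hist I X n ω)} ≤ 1 := by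
  classical
  let Z : ∀ n, History K n → ℝ≥0∞ := stoppedAtLevel M c
  have hZs : ∀ n (h : History K (n + 1)), Z (n + 1) h =
      if c ≤ Z n (fun s => h s.castSucc) then Z n (fun s => h s.castSucc) else M (n + 1) h :=
    fun n h => by simp only [Z, stoppedAtLevel]
  have hZm : ∀ n, Measurable (Z n) := by
    intro n
    induction n with
    | zero => exact hM 0
    | succ n ih =>
      have hr : Measurable fun h : History K (n + 1) => (fun s => h s.castSucc : History K n) :=
        measurable_pi_iff.2 fun s => measurable_pi_apply _
      exact Measurable.ite (measurableSet_le measurable_const (ih.comp hr)) (ih.comp hr) (hM _)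
  have hZM : ∀ n h, Z n h < c → Z n h = M n h := by
    intro n h
    cases n with
    | zero => intro _; rfl
    | succ n =>
      rw [hZs]
      split_ifs with hc
      · intro h'; exact absurd hc (not_le.2 h')
      · intro _; rfl
  have hext : ∀ n (h : History K n) p, (fun s => extend h p (Fin.castSucc s)) = h := by
    intro n h p; funext s; simp [extend]
  -- A step either leaves the frozen value unchanged or is a step of the supermartingale `M`.
  have hint : ∀ n, ∫⁻ ω, Z n (hist I X n ω) ∂P ≤ 1 := by
    intro n
    induction n with
    | zero =>
      calc ∫⁻ ω, Z 0 (hist I X 0 ω) ∂P ≤ ∫⁻ _, 1 ∂P := lintegral_mono fun ω => hM0 _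
        _ = 1 := by simp
    | succ n ih =>
      rw [h.lintegral_hist_succ (hZm (n + 1))]
      refine le_trans (lintegral_mono fun ω => ?_) ih
      have := π.isMarkov n
      have hx : ∀ a, ∫⁻ x, Z (n + 1) (extend (hist I X n ω) (a, x)) ∂gaussianReal (μ a) v ≤
          Z n (hist I X n ω) := by
        intro a
        simp_rw [hZs, hext]
        split_ifs with hc
        · simp
        · rw [hZM n _ (not_le.1 hc)]
          exact hstep n _ a
      calc _ ≤ ∫⁻ _, Z n (hist I X n ω) ∂π.rule n (hist I X n ω) := lintegral_mono hx
        _ = _ := by simp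
  have hmono : ∀ n ω, c ≤ Z n (hist I X n ω) → c ≤ Z (n + 1) (hist I X (n + 1) ω) := by
    intro n ω hc
    rw [hist_succ, hZs, hext, if_pos hc]
    exact hc
  have hreach : ∀ n ω, c ≤ M n (hist I X n ω) → c ≤ Z n (hist I X n ω) := by
    intro n ω hc
    by_contra hlt
    exact hlt (hZM n _ (not_le.1 hlt) ▸ hc)
  have hsub : {ω | ∃ n, c ≤ M n (hist I X n ω)} ⊆ ⋃ n, {ω | c ≤ Z n (hist I X n ω)} := by
    rintro ω ⟨n, hn⟩
    exact Set.mem_iUnion.2 ⟨n, hreach n ω hn⟩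
  -- Freezing makes the crossing events increase in `n`, so Markov's inequality at each fixed time
  -- controls their union.
  have hU : Monotone fun n => {ω | c ≤ Z n (hist I X n ω)} :=
    monotone_nat_of_le_succ fun n ω hω => hmono n ω hω
  calc c * P {ω | ∃ n, c ≤ M n (hist I X n ω)}
      ≤ c * P (⋃ n, {ω | c ≤ Z n (hist I X n ω)}) := by gcongr
    _ = ⨆ n, c * P {ω | c ≤ Z n (hist I X n ω)} := by
        rw [hU.measure_iUnion, ENNReal.mul_iSup]
    _ ≤ 1 := iSup_le fun n =>
        (mul_meas_ge_le_lintegral₀ ((hZm n).comp_aemeasurable (h.aemeasurable_hist n)) c).trans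
          (hint n)

/-! ### The evidence martingale -/

/-- The sum of the centred observations of arm `k`. -/
noncomputable def centredSum (μ : Fin K → ℝ) {n : ℕ} (h : History K n) (k : Fin K) : ℝ :=
  ∑ s, if (h s).1 = k then (h s).2 - μ k else 0

lemma count_eq_sum {n : ℕ} (h : History K n) (k : Fin K) :
    count h k = ∑ s, if (h s).1 = k then 1 else 0 := by
  rw [count, Finset.card_filter]

lemma count_extend {n : ℕ} (h : History K n) (a k : Fin K) (x : ℝ) :
    count (extend h (a, x)) k = count h k + if a = k then 1 else 0 := by
  simp [count_eq_sum, Fin.sum_univ_castSucc, extend, -Finset.sum_boole]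

lemma centredSum_extend (μ : Fin K → ℝ) {n : ℕ} (h : History K n) (a k : Fin K) (x : ℝ) :
    centredSum μ (extend h (a, x)) k = centredSum μ h k + if a = k then x - μ k else 0 := by
  simp [centredSum, Fin.sum_univ_castSucc, extend]

lemma measurableSet_arm_eq {n : ℕ} (s : Fin n) (k : Fin K) :
    MeasurableSet {h : History K n | (h s).1 = k} :=
  (measurable_fst.comp (measurable_pi_apply s)) (measurableSet_singleton k)

lemma measurable_count {n : ℕ} (k : Fin K) :
    Measurable fun h : History K n => count h k := by
  simp_rw [count_eq_sum]
  exact Finset.measurable_sum _ fun s _ =>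
    Measurable.ite (measurableSet_arm_eq s k) measurable_const measurable_const

lemma measurable_centredSum (μ : Fin K → ℝ) {n : ℕ} (k : Fin K) :
    Measurable fun h : History K n => centredSum μ h k :=
  Finset.measurable_sum _ fun s _ => Measurable.ite (measurableSet_arm_eq s k)
    ((measurable_snd.comp (measurable_pi_apply s)).sub measurable_const) measurable_const

/-- The product over the arms in `T` of their evidence against the means `μ`. -/
noncomputable def jointEvidence (ρ : Measure ℝ) (v : ℝ≥0) (μ : Fin K → ℝ) (T : Finset (Fin K))
    (n : ℕ) (h : History K n) : ℝ≥0∞ :=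
  ∏ k ∈ T, evidence ρ v (count h k) (centredSum μ h k)

lemma measurable_jointEvidence (ρ : Measure ℝ) [SFinite ρ] (v : ℝ≥0) (μ : Fin K → ℝ)
    (T : Finset (Fin K)) (n : ℕ) : Measurable (jointEvidence ρ v μ T n) :=
  Finset.measurable_prod _ fun k _ =>
    (measurable_evidence ρ v).comp ((measurable_count k).prodMk (measurable_centredSum μ k))

lemma jointEvidence_zero (ρ : Measure ℝ) [IsProbabilityMeasure ρ] (v : ℝ≥0) (μ : Fin K → ℝ)
    (T : Finset (Fin K)) (h : History K 0) : jointEvidence ρ v μ T 0 h = 1 := by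
  simp [jointEvidence, count, centredSum, evidence_zero]

/-- Only the factor of the pulled arm changes, whichever arm it is; hence a martingale under any
sampling rule. -/
lemma lintegral_jointEvidence_succ (ρ : Measure ℝ) [SFinite ρ] (v : ℝ≥0) (μ : Fin K → ℝ)
    (T : Finset (Fin K)) {n : ℕ} (h : History K n) (a : Fin K) :
    ∫⁻ x, jointEvidence ρ v μ T (n + 1) (extend h (a, x)) ∂gaussianReal (μ a) v =
      jointEvidence ρ v μ T n h := by
  simp only [jointEvidence, count_extend, centredSum_extend]
  have hne : ∀ T' : Finset (Fin K), a ∉ T' → ∀ x : ℝ,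
      ∏ k ∈ T', evidence ρ v (count h k + if a = k then 1 else 0)
        (centredSum μ h k + if a = k then x - μ k else 0) =
      ∏ k ∈ T', evidence ρ v (count h k) (centredSum μ h k) := by
    intro T' ha x
    refine Finset.prod_congr rfl fun k hk => ?_
    have : a ≠ k := fun h => ha (h ▸ hk)
    simp [this]
  by_cases ha : a ∈ T
  · simp_rw [← Finset.mul_prod_erase T _ ha, hne _ (Finset.notMem_erase a T)]
    have hm : Measurable fun x : ℝ => evidence ρ v (count h a + 1) (centredSum μ h a + (x - μ a)) :=
      (measurable_evidence ρ v).comp (measurable_const.prodMk (by fun_prop))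
    simp only [if_true]
    rw [lintegral_mul_const _ hm, lintegral_evidence_succ]
  · simp_rw [hne T ha]
    simp

/-! ### The function `gG` -/

/-- The Riemann zeta function on `(1, ∞)`, as a real series. -/
noncomputable def zetaSum (s : ℝ) : ℝ := ∑' n : ℕ, 1 / ((n : ℝ) + 1) ^ s

lemma summable_zetaSum {s : ℝ} (hs : 1 < s) : Summable fun n : ℕ => 1 / ((n : ℝ) + 1) ^ s := by
  have := (summable_nat_add_iff 1).2 (Real.summable_one_div_nat_rpow.2 hs)
  simpa using this

lemma riemannZeta_re_eq_zetaSum {s : ℝ} (hs : 1 < s) : (riemannZeta (s : ℂ)).re = zetaSum s := by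
  rw [zeta_eq_tsum_one_div_nat_add_one_cpow (by simpa using hs), zetaSum]
  have h : ∀ n : ℕ, 1 / ((n : ℂ) + 1) ^ (s : ℂ) = ((1 / ((n : ℝ) + 1) ^ s : ℝ) : ℂ) := by
    intro n
    rw [Complex.ofReal_div, Complex.ofReal_cpow (by positivity)]
    simp
  simp_rw [h]
  rw [← Complex.ofReal_tsum, Complex.ofReal_re]

/-- The first two terms of the series suffice. Being uniform in `s`, the bound keeps `log ζ` away
from zero. -/
lemma five_div_four_le_zetaSum {s : ℝ} (hs : 1 < s) (hs' : s ≤ 2) : 5 / 4 ≤ zetaSum s := by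
  have h := (summable_zetaSum hs).sum_le_tsum (Finset.range 2) fun n _ => by positivity
  have h2 : (2 : ℝ) ^ s ≤ 4 := by
    calc (2 : ℝ) ^ s ≤ (2 : ℝ) ^ (2 : ℝ) := Real.rpow_le_rpow_of_exponent_le (by norm_num) hs'
      _ = 4 := by norm_num
  have h3 : (1 / 4 : ℝ) ≤ 1 / (2 : ℝ) ^ s := one_div_le_one_div_of_le (by positivity) h2
  refine le_trans ?_ h
  simp only [Finset.sum_range_succ, Finset.sum_range_zero]
  norm_num [one_add_one_eq_two] at h3 ⊢
  linarith

lemma zetaSum_le_zetaSum {s t : ℝ} (hs : 1 < s) (hst : s ≤ t) : zetaSum t ≤ zetaSum s := by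
  refine (summable_zetaSum (hs.trans_le hst)).tsum_le_tsum (fun n => ?_) (summable_zetaSum hs)
  exact one_div_le_one_div_of_le (by positivity)
    (Real.rpow_le_rpow_of_exponent_le (by simp) hst)

/-- The logarithmic price of the mixture with parameter `l`: `gG l` with `log ζ(2 l)` in place of
`2 log ζ(2 l)`. -/
noncomputable def mixturePrice (l : ℝ) : ℝ :=
  2 * l - 2 * l * Real.log (4 * l) + Real.log (zetaSum (2 * l)) - 1 / 2 * Real.log (1 - l)

lemma gG_eq {l : ℝ} (hl : 1 / 2 < l) : gG l = 2 * l - 2 * l * Real.log (4 * l) +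
    2 * Real.log (zetaSum (2 * l)) - 1 / 2 * Real.log (1 - l) := by
  rw [gG, riemannZeta_re_eq_zetaSum (by linarith)]

lemma log_zetaSum_ge {l : ℝ} (hl : l ∈ Set.Ioo (1 / 2 : ℝ) 1) :
    Real.log (5 / 4) ≤ Real.log (zetaSum (2 * l)) :=
  Real.log_le_log (by norm_num)
    (five_div_four_le_zetaSum (by linarith [hl.1]) (by linarith [hl.2]))

lemma gG_ge {l : ℝ} (hl : l ∈ Set.Ioo (1 / 2 : ℝ) 1) :
    2 * l - 2 * l * Real.log 4 - 1 / 2 * Real.log (1 - l) ≤ gG l := by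
  have h1 : Real.log (4 * l) ≤ Real.log 4 :=
    Real.log_le_log (by linarith [hl.1]) (by linarith [hl.2])
  have h2 := log_zetaSum_ge hl
  have h3 : 0 ≤ Real.log (5 / 4) := Real.log_nonneg (by norm_num)
  have h4 : 2 * l * Real.log (4 * l) ≤ 2 * l * Real.log 4 :=
    mul_le_mul_of_nonneg_left h1 (by linarith [hl.1])
  rw [gG_eq hl.1]
  linarith

instance : Nonempty (Set.Ioo (1 / 2 : ℝ) 1) := ⟨⟨3 / 4, by norm_num⟩⟩

/-- For `x ≥ 0` the infimum defining `CG` is bounded below, with a bound that grows with `x`. -/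
lemma le_gG_add_div {l x : ℝ} (hl : l ∈ Set.Ioo (1 / 2 : ℝ) 1) (hx : 0 ≤ x) :
    2 - 2 * Real.log 4 + x * (2 - l) - 1 / 2 * Real.log (1 - l) ≤ (gG l + x) / l := by
  have hl0 : 0 < l := by linarith [hl.1]
  have h1 := gG_ge hl
  have h2 : Real.log (1 - l) ≤ 0 := Real.log_nonpos (by linarith [hl.2]) (by linarith)
  rw [le_div_iff₀ hl0]
  -- `(1 - l)² ≥ 0` gives `1 / l ≥ 2 - l`, while the nonnegative term `-log (1 - l) / 2` only grows
  -- on division by `l < 1`.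
  nlinarith [mul_nonneg hx (sq_nonneg (1 - l)), mul_nonneg_of_nonpos_of_nonpos h2
    (by linarith [hl.2] : l - 1 ≤ 0)]

lemma le_CG {x b : ℝ} (h : ∀ l ∈ Set.Ioo (1 / 2 : ℝ) 1, b ≤ (gG l + x) / l) : b ≤ CG x :=
  le_ciInf fun l => h l l.2

lemma two_sub_two_mul_log_four_le_CG {x : ℝ} (hx : 0 ≤ x) : 2 - 2 * Real.log 4 ≤ CG x := by
  refine le_CG fun l hl => le_trans ?_ (le_gG_add_div hl hx)
  have h2 : Real.log (1 - l) ≤ 0 :=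
    Real.log_nonpos (by linarith [hl.2]) (by linarith [hl.1])
  have := mul_nonneg hx (by linarith [hl.2] : 0 ≤ 2 - l)
  linarith

/-- The factor `2` in front of `log ζ` in `gG` leaves room for a strict inequality, so that the
infimum `CG x` need not be attained. -/
lemma exists_mixturePrice_add_lt (x : ℝ) :
    ∃ l ∈ Set.Ioo (1 / 2 : ℝ) 1, mixturePrice l + x < l * CG x := by
  have hε : 0 < Real.log (5 / 4) := Real.log_pos (by norm_num)
  obtain ⟨⟨l, hl⟩, h⟩ := exists_lt_of_ciInf_lt
    (show (⨅ l : Set.Ioo (1 / 2 : ℝ) 1, (gG l + x) / l) < CG x + Real.log (5 / 4) from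
      lt_add_of_pos_right _ hε)
  have hl0 : 0 < l := by linarith [hl.1]
  refine ⟨l, hl, ?_⟩
  simp only at h
  rw [div_lt_iff₀ hl0, gG_eq hl.1] at h
  have h2 := log_zetaSum_ge hl
  have h3 := mul_lt_mul_of_pos_right hl.2 hε
  rw [mixturePrice]
  nlinarith

/-! ### The mixture prior -/

/-- The ratio of the variance of the `i`-th component of the prior to `1 / v`. -/
noncomputable def priorScale (l : ℝ) (i : ℕ) : ℝ := l / (1 - l) * Real.exp (-(4 * l * i))

/-- The prior: a mixture of centred Gaussian laws with geometrically decreasing variances. -/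
noncomputable def prior (v : ℝ≥0) (l : ℝ) : Measure ℝ :=
  Measure.sum fun i : ℕ => ENNReal.ofReal (1 / ((i : ℝ) + 1) ^ (2 * l) / zetaSum (2 * l)) •
    gaussianReal 0 (priorScale l i / v).toNNReal

lemma isProbabilityMeasure_prior (v : ℝ≥0) {l : ℝ} (hl : l ∈ Set.Ioo (1 / 2 : ℝ) 1) :
    IsProbabilityMeasure (prior v l) := by
  have hs := summable_zetaSum (s := 2 * l) (by linarith [hl.1])
  have hZ : 0 < zetaSum (2 * l) := by
    linarith [five_div_four_le_zetaSum (s := 2 * l) (by linarith [hl.1]) (by linarith [hl.2])]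
  refine ⟨?_⟩
  rw [prior, Measure.sum_apply _ MeasurableSet.univ]
  simp only [Measure.smul_apply, measure_univ, smul_eq_mul, mul_one]
  rw [← ENNReal.ofReal_tsum_of_nonneg (fun n => by positivity) (hs.div_const _), tsum_div_const]
  change ENNReal.ofReal (zetaSum (2 * l) / zetaSum (2 * l)) = 1
  rw [div_self hZ.ne', ENNReal.ofReal_one]

lemma le_evidence_prior_component (v : ℝ≥0) (l : ℝ) (N : ℕ) (S : ℝ) (i : ℕ) :
    ENNReal.ofReal (1 / ((i : ℝ) + 1) ^ (2 * l) / zetaSum (2 * l)) *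
      evidence (gaussianReal 0 (priorScale l i / v).toNNReal) v N S ≤
    evidence (prior v l) v N S := by
  rw [prior]
  unfold evidence
  rw [lintegral_sum_measure]
  refine le_trans (le_of_eq ?_) (ENNReal.le_tsum i)
  rw [lintegral_smul_measure, smul_eq_mul]

/-- A single component, the one whose variance matches the sample size, already suffices. Its weight
costs `2 l log (i + 1) + log ζ(2 l)` and its normalisation `log (1 + A) / 2`; these add up to
`mixturePrice l` and the iterated logarithm. -/
lemma le_evidence_prior {v : ℝ≥0} (hv : v ≠ 0) {l : ℝ} (hl : l ∈ Set.Ioo (1 / 2 : ℝ) 1)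
    {N : ℕ} (hN : N ≠ 0) (S : ℝ) :
    ENNReal.ofReal (Real.exp
      (l * (S ^ 2 / (2 * v * N) - 2 * Real.log (4 + Real.log N)) - mixturePrice l)) ≤
    evidence (prior v l) v N S := by
  have hl0 : 0 < l := by linarith [hl.1]
  have hl1 : 0 < 1 - l := by linarith [hl.2]
  have hv' : (0 : ℝ) < v := by positivity
  have hN' : (0 : ℝ) < N := by positivity
  have hN1 : (1 : ℝ) ≤ N := by exact_mod_cast Nat.one_le_iff_ne_zero.2 hN
  have hlogN : 0 ≤ Real.log N := Real.log_nonneg hN1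
  have hZ : 0 < zetaSum (2 * l) := by
    linarith [five_div_four_le_zetaSum (s := 2 * l) (by linarith [hl.1]) (by linarith [hl.2])]
  -- This index gives `exp (4 l i) ≤ N ≤ exp (4 l (i + 1))`, hence `A` lies within a factor `exp (4
  -- l)` above `l / (1 - l)`.
  set i : ℕ := ⌊Real.log N / (4 * l)⌋₊ with hi
  have hi1 : 4 * l * i ≤ Real.log N := by
    have := Nat.floor_le (show 0 ≤ Real.log N / (4 * l) by positivity)
    rw [le_div_iff₀ (by positivity)] at this
    linarith
  have hi2 : Real.log N ≤ 4 * l * i + 4 * l := by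
    have := (Nat.lt_floor_add_one (Real.log N / (4 * l))).le
    rw [div_le_iff₀ (by positivity)] at this
    linarith
  have ha : 0 < priorScale l i := by unfold priorScale; positivity
  have hEN : Real.exp (-(4 * l * i)) * N = Real.exp (Real.log N - 4 * l * i) := by
    rw [sub_eq_add_neg, Real.exp_add, Real.exp_log hN', mul_comm]
  have haN1 : l / (1 - l) ≤ priorScale l i * N := by
    rw [priorScale, mul_assoc, hEN]
    exact le_mul_of_one_le_right (by positivity) (Real.one_le_exp (by linarith))
  have haN2 : priorScale l i * N ≤ l / (1 - l) * Real.exp (4 * l) := by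
    rw [priorScale, mul_assoc, hEN]
    gcongr
    linarith
  have hτ : (priorScale l i / v).toNNReal ≠ 0 := by
    rw [ne_eq, Real.toNNReal_eq_zero, not_le]; positivity
  refine le_trans ?_ (le_evidence_prior_component v l N S i)
  rw [evidence_gaussianReal hτ, ← ENNReal.ofReal_mul (by positivity), ← mul_assoc]
  refine ENNReal.ofReal_le_ofReal ?_
  rw [Real.coe_toNNReal _ (by positivity), div_mul_cancel₀ _ hv'.ne']
  set A : ℝ := priorScale l i * N with hA
  have hA0 : 0 < A := by positivity
  have hw : 1 / ((i : ℝ) + 1) ^ (2 * l) / zetaSum (2 * l) =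
      Real.exp (-(2 * l * Real.log (i + 1)) - Real.log (zetaSum (2 * l))) := by
    rw [Real.exp_sub, Real.exp_log hZ, Real.exp_neg, one_div, Real.rpow_def_of_pos (by positivity)]
    congr 3
    ring
  have hr : (√(1 + A))⁻¹ = Real.exp (-(Real.log (1 + A) / 2)) := by
    rw [Real.exp_neg, ← Real.log_sqrt (by positivity), Real.exp_log (by positivity)]
  rw [hw, hr, ← Real.exp_add, ← Real.exp_add, Real.exp_le_exp]
  have h1 : Real.log (i + 1) ≤ Real.log (4 + Real.log N) - Real.log (4 * l) := by
    rw [← Real.log_div (by positivity) (by positivity)]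
    refine Real.log_le_log (by positivity) ?_
    rw [le_div_iff₀ (by positivity)]
    linarith [hl.2]
  have h2 : Real.log (1 + A) ≤ 4 * l - Real.log (1 - l) := by
    rw [Real.log_le_iff_le_exp (by positivity), Real.exp_sub, Real.exp_log hl1, le_div_iff₀ hl1]
    have h := mul_le_mul_of_nonneg_right haN2 hl1.le
    have h' : l / (1 - l) * Real.exp (4 * l) * (1 - l) = l * Real.exp (4 * l) := by
      field_simp
    have h'' : 1 ≤ Real.exp (4 * l) := Real.one_le_exp (by positivity)
    nlinarith
  -- `A ≥ l / (1 - l)` is equivalent to `A / (1 + A) ≥ l`: this is what fixes the scale of the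
  -- prior.
  have h3 : l * (S ^ 2 / (2 * v * N)) ≤ priorScale l i / v / (1 + A) * S ^ 2 / 2 := by
    have h : priorScale l i / v / (1 + A) * S ^ 2 / 2 = A / (1 + A) * (S ^ 2 / (2 * v * N)) := by
      rw [hA]; field_simp
    rw [h]
    refine mul_le_mul_of_nonneg_right ?_ (by positivity)
    rw [le_div_iff₀ (by positivity)]
    rw [div_le_iff₀ hl1] at haN1
    linarith
  have h4 := mul_le_mul_of_nonneg_left h1 (by positivity : 0 ≤ 2 * l)
  rw [mixturePrice]
  linarith

/-! ### Deviations of two empirical means -/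

lemma centredSum_eq (μ : Fin K → ℝ) {n : ℕ} (h : History K n) (k : Fin K) :
    centredSum μ h k =
      ∑ s ∈ Finset.univ.filter (fun s => (h s).1 = k), (h s).2 - count h k * μ k := by
  rw [centredSum, ← Finset.sum_filter, Finset.sum_sub_distrib, Finset.sum_const, nsmul_eq_mul,
    count]

lemma count_mul_kl {v : ℝ≥0} (hv : v ≠ 0) (μ : Fin K → ℝ) {n : ℕ} (h : History K n) {k : Fin K}
    (hk : count h k ≠ 0) :
    count h k * kl v (empMean h k) (μ k) = centredSum μ h k ^ 2 / (2 * v * count h k) := by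
  have hk' : (count h k : ℝ) ≠ 0 := by exact_mod_cast hk
  have hv' : (v : ℝ) ≠ 0 := by exact_mod_cast hv
  rw [kl_eq hv, empMean, centredSum_eq]
  field_simp

lemma transportCost_le (v : ℝ≥0) {n : ℕ} (h : History K n) (i j : Fin K) {a b : ℝ} (hab : a ≤ b) :
    transportCost v h i j ≤
      count h i * kl v (empMean h i) a + count h j * kl v (empMean h j) b := by
  refine ciInf_le (f := fun θ : {θ : ℝ × ℝ // θ.1 ≤ θ.2} =>
    count h i * kl v (empMean h i) θ.1.1 + count h j * kl v (empMean h j) θ.1.2)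
    ⟨0, ?_⟩ ⟨(a, b), hab⟩
  rintro _ ⟨θ, rfl⟩
  have : ∀ x y, 0 ≤ kl v x y := fun x y => ENNReal.toReal_nonneg
  exact add_nonneg (mul_nonneg (Nat.cast_nonneg _) (this _ _))
    (mul_nonneg (Nat.cast_nonneg _) (this _ _))

/-- If one arm is unpulled, placing both parameters at the other arm's empirical mean costs nothing.
-/
lemma count_ne_zero_of_transportCost_pos {v : ℝ≥0} {n : ℕ} {h : History K n} {i j : Fin K}
    (hpos : 0 < transportCost v h i j) : count h i ≠ 0 ∧ count h j ≠ 0 := by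
  have hself : ∀ x, kl v x x = 0 := fun x => by simp [kl]
  constructor
  · intro h0
    have := transportCost_le v h i j (le_refl (empMean h j))
    simp [h0, hself] at this
    linarith
  · intro h0
    have := transportCost_le v h i j (le_refl (empMean h i))
    simp [h0, hself] at this
    linarith

lemma count_add_count_le {n : ℕ} (h : History K n) {i j : Fin K} (hij : i ≠ j) :
    count h i + count h j ≤ n := by
  rw [count_eq_sum, count_eq_sum, ← Finset.sum_add_distrib]
  calc _ ≤ ∑ _s : Fin n, 1 := by
        refine Finset.sum_le_sum fun s _ => ?_
        by_cases h1 : (h s).1 = i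
        · simp [h1, hij]
        · simp only [h1, if_false, zero_add]
          split_ifs <;> simp
    _ = n := by simp

lemma log_exp_four_mul_div_two {t : ℝ} (ht : 0 < t) :
    Real.log (Real.exp 4 * t / 2) = 4 + Real.log (t / 2) := by
  rw [mul_div_assoc, Real.log_mul (by positivity) (by positivity), Real.log_exp]

/-- The arithmetic-geometric mean inequality is applied twice, to `a`, `b` and then to `4 + log a`,
`4 + log b`. The two arms share at most `t` pulls, hence `t / 2` in the threshold. -/
lemma log_log_add_log_log_le {a b t : ℝ} (ha : 1 ≤ a) (hb : 1 ≤ b) (hab : a + b ≤ t) :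
    Real.log (4 + Real.log a) + Real.log (4 + Real.log b) ≤
      2 * Real.log (Real.log (Real.exp 4 * t / 2)) := by
  have hla := Real.log_nonneg ha
  have hlb := Real.log_nonneg hb
  have h1 : Real.log a + Real.log b ≤ 2 * Real.log (t / 2) := by
    rw [← Real.log_mul (by positivity) (by positivity)]
    calc Real.log (a * b) ≤ Real.log ((t / 2) ^ 2) :=
          Real.log_le_log (by positivity) (by nlinarith [sq_nonneg (a - b)])
      _ = 2 * Real.log (t / 2) := by rw [Real.log_pow]; norm_num
  rw [log_exp_four_mul_div_two (by linarith), ← Real.log_mul (by positivity) (by positivity)]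
  calc Real.log ((4 + Real.log a) * (4 + Real.log b))
      ≤ Real.log ((4 + Real.log (t / 2)) ^ 2) :=
        Real.log_le_log (by positivity) (by nlinarith [sq_nonneg (Real.log a - Real.log b)])
    _ = 2 * Real.log (4 + Real.log (t / 2)) := by rw [Real.log_pow]; norm_num

lemma log_sub_one_div_pos (hK : 2 ≤ K) {δ : ℝ} (hδ : δ ∈ Set.Ioo (0 : ℝ) 1) :
    0 < Real.log (((K : ℝ) - 1) / δ) := by
  have : (2 : ℝ) ≤ K := by exact_mod_cast hK
  refine Real.log_pos ((one_lt_div hδ.1).2 (by linarith [hδ.2]))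

/-- Positivity ensures that both compared arms have been pulled at stopping, as `le_evidence_prior`
needs `N ≠ 0`. -/
lemma threshold_pos (hK : 2 ≤ K) {δ : ℝ} (hδ : δ ∈ Set.Ioo (0 : ℝ) 1) {n : ℕ} (hn : 1 ≤ n) :
    0 < threshold K δ n := by
  have hn' : (1 : ℝ) ≤ n := by exact_mod_cast hn
  have h1 := two_sub_two_mul_log_four_le_CG (x := 1 / 2 * Real.log (((K : ℝ) - 1) / δ))
    (by linarith [log_sub_one_div_pos hK hδ])
  have h4 : Real.log 4 = 2 * Real.log 2 := by
    rw [show (4 : ℝ) = 2 ^ 2 by norm_num, Real.log_pow]; norm_num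
  have h2 := Real.log_two_lt_d9
  have h3 : 1 ≤ Real.log (Real.log (Real.exp 4 * n / 2)) := by
    have h5 : 3 ≤ Real.log (Real.exp 4 * n / 2) := by
      rw [log_exp_four_mul_div_two (by linarith), Real.log_div (by positivity) (by norm_num)]
      linarith [Real.log_nonneg hn']
    rw [Real.le_log_iff_exp_le (by linarith)]
    linarith [Real.exp_one_lt_d9]
  rw [threshold]
  linarith

lemma le_jointEvidence {v : ℝ≥0} (hv : v ≠ 0) (hK : 2 ≤ K) {δ : ℝ} (hδ : δ ∈ Set.Ioo (0 : ℝ) 1)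
    {l : ℝ} (hl : l ∈ Set.Ioo (1 / 2 : ℝ) 1)
    (hCG : mixturePrice l + 1 / 2 * Real.log (((K : ℝ) - 1) / δ) <
      l * CG (1 / 2 * Real.log (((K : ℝ) - 1) / δ)))
    {μ : Fin K → ℝ} {i j : Fin K} (hij : i ≠ j) (hμ : μ i ≤ μ j) {n : ℕ} (hn : 1 ≤ n)
    {h : History K n} (hW : threshold K δ n ≤ transportCost v h i j) :
    ENNReal.ofReal (((K : ℝ) - 1) / δ) ≤ jointEvidence (prior v l) v μ {i, j} n h := by
  have hl0 : 0 < l := by linarith [hl.1]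
  have hq : 0 < ((K : ℝ) - 1) / δ := by
    have : (2 : ℝ) ≤ K := by exact_mod_cast hK
    exact div_pos (by linarith) hδ.1
  obtain ⟨hi, hj⟩ := count_ne_zero_of_transportCost_pos ((threshold_pos hK hδ hn).trans_le hW)
  have hle := hW.trans (transportCost_le v h i j hμ)
  rw [count_mul_kl hv μ h hi, count_mul_kl hv μ h hj, threshold] at hle
  have hlog := log_log_add_log_log_le (a := count h i) (b := count h j) (t := n)
    (by exact_mod_cast Nat.one_le_iff_ne_zero.2 hi) (by exact_mod_cast Nat.one_le_iff_ne_zero.2 hj)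
    (by exact_mod_cast count_add_count_le h hij)
  rw [jointEvidence, Finset.prod_pair hij]
  refine le_trans ?_ (mul_le_mul' (le_evidence_prior hv hl hi (centredSum μ h i))
    (le_evidence_prior hv hl hj (centredSum μ h j)))
  rw [← ENNReal.ofReal_mul (Real.exp_pos _).le, ← Real.exp_add]
  refine ENNReal.ofReal_le_ofReal ?_
  rw [← Real.log_le_iff_le_exp hq]
  -- With `x = log ((K - 1) / δ) / 2`, the iterated logarithms cancel and each arm pays
  -- `mixturePrice l`; what remains is `2 (l * CG x - mixturePrice l) > 2 x`.
  have h1 := mul_le_mul_of_nonneg_left hle hl0.le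
  have h2 := mul_le_mul_of_nonneg_left hlog hl0.le
  linarith

/-! ### Correctness -/

lemma exists_neighbor_mean_ge {μ : Fin K → ℝ} {b : Fin K}
    (hup : ∀ j k : Fin K, (k : ℕ) = j + 1 → j < b → μ j ≤ μ k)
    (hdown : ∀ j k : Fin K, (k : ℕ) = j + 1 → b ≤ j → μ k ≤ μ j) {i : Fin K} (hi : i ≠ b) :
    ∃ j ∈ neighbors i, i ≠ j ∧ μ i ≤ μ j := by
  rcases lt_or_gt_of_ne hi with h | h
  · have h' : (i : ℕ) < b := h
    refine ⟨⟨i + 1, by omega⟩, Or.inl rfl, ?_, hup _ _ rfl h⟩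
    rw [ne_eq, Fin.ext_iff]; simp
  · have h' : (b : ℕ) < i := h
    refine ⟨⟨i - 1, by omega⟩, Or.inr (by simp; omega), ?_, hdown _ _ (by simp; omega) ?_⟩
    · rw [ne_eq, Fin.ext_iff]; simp; omega
    · rw [Fin.le_def]; simp; omega

lemma localCost_le (v : ℝ≥0) {n : ℕ} (h : History K n) {i j : Fin K} (hj : j ∈ neighbors i) :
    localCost v h i ≤ transportCost v h i j :=
  ciInf_le (f := fun j : neighbors i => transportCost v h i j) (Set.finite_range _).bddBelow ⟨j, hj⟩

/-- The infimum is attained: were `n` not a stopping index, all of them would be at least `n + 1`.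
-/
lemma mem_stopSet_of_stoppingTime_eq {Ω : Type*} {A : Algorithm K} {I : ℕ → Ω → Fin K}
    {X : ℕ → Ω → ℝ} {ω : Ω} {n : ℕ} (h : stoppingTime A I X ω = ((n + 1 : ℕ) : ℕ∞)) :
    hist I X n ω ∈ A.stopSet n := by
  by_contra hn
  have h2 : ((n + 2 : ℕ) : ℕ∞) ≤ stoppingTime A I X ω := by
    refine le_iInf₂ fun m hm => ?_
    have h1 : stoppingTime A I X ω ≤ ((m + 1 : ℕ) : ℕ∞) := iInf₂_le m hm
    rw [h] at h1
    have h3 : n + 1 ≤ m + 1 := by exact_mod_cast h1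
    have h4 : m ≠ n := by rintro rfl; exact hn hm
    exact_mod_cast (by omega : n + 2 ≤ m + 1)
  rw [h] at h2
  have : n + 2 ≤ n + 1 := by exact_mod_cast h2
  omega

theorem isDeltaCorrect_localGLR (hK : 2 ≤ K) {v : ℝ≥0} (hv : v ≠ 0) {δ : ℝ}
    (hδ : δ ∈ Set.Ioo (0 : ℝ) 1) (π : SamplingRule K) (ρ : ∀ n, History K n → Fin K) :
    IsDeltaCorrect (localGLR v (threshold K δ) π ρ) v δ := by
  rintro μ ⟨b, hb, hup, hdown⟩ Ω _ P _ I X hint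
  obtain ⟨l, hl, hCG⟩ := exists_mixturePrice_add_lt (1 / 2 * Real.log (((K : ℝ) - 1) / δ))
  have := isProbabilityMeasure_prior v hl
  have hK' : (0 : ℝ) < (K : ℝ) - 1 := by
    have : (2 : ℝ) ≤ K := by exact_mod_cast hK
    linarith
  -- The neighbour is chosen from `i` and `μ` alone, before any data, so there is one event per
  -- wrong arm.
  have hex : ∀ i : Fin K, ∃ j, i ≠ b → j ∈ neighbors i ∧ i ≠ j ∧ μ i ≤ μ j := by
    intro i
    by_cases hi : i = b
    · exact ⟨i, fun h => absurd hi h⟩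
    · obtain ⟨j, hj⟩ := exists_neighbor_mean_ge hup hdown hi
      exact ⟨j, fun _ => hj⟩
  choose f hf using hex
  set c : ℝ≥0∞ := ENNReal.ofReal (((K : ℝ) - 1) / δ) with hc
  let E : Fin K → Set Ω := fun i =>
    {ω | ∃ n, c ≤ jointEvidence (prior v l) v μ {i, f i} n (hist I X n ω)}
  have hE : ∀ i, P (E i) ≤ ENNReal.ofReal (δ / ((K : ℝ) - 1)) := by
    intro i
    have h := hint.mul_measure_exists_le (M := jointEvidence (prior v l) v μ {i, f i})
      (measurable_jointEvidence _ v μ _) (fun h => (jointEvidence_zero _ v μ _ h).le)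
      (fun n h a => (lintegral_jointEvidence_succ _ v μ _ h a).le) c
    rw [← inv_div, ENNReal.ofReal_inv_of_pos (div_pos hK' hδ.1), ENNReal.le_inv_iff_mul_le,
      mul_comm]
    exact h
  have hsub : errorEvent (localGLR v (threshold K δ) π ρ) μ I X ⊆
      ⋃ i ∈ Finset.univ.erase b, E i := by
    rintro ω ⟨n, hτ, hbest⟩
    obtain ⟨hn, hcost⟩ := mem_stopSet_of_stoppingTime_eq hτ
    have hi : ρ n (hist I X n ω) ≠ b := by
      intro h
      apply hbest
      rw [hb]
      exact h
    obtain ⟨hnb, hne, hμ⟩ := hf _ hi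
    simp only [Set.mem_iUnion]
    exact ⟨_, Finset.mem_erase.2 ⟨hi, Finset.mem_univ _⟩, n,
      le_jointEvidence hv hK hδ hl hCG hne hμ hn (hcost.trans (localCost_le v _ hnb))⟩
  calc P (errorEvent (localGLR v (threshold K δ) π ρ) μ I X)
      ≤ P (⋃ i ∈ Finset.univ.erase b, E i) := measure_mono hsub
    _ ≤ ∑ i ∈ Finset.univ.erase b, P (E i) := measure_biUnion_finset_le _ _
    _ ≤ ∑ _i ∈ Finset.univ.erase b, ENNReal.ofReal (δ / ((K : ℝ) - 1)) :=
        Finset.sum_le_sum fun i _ => hE i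
    _ = ENNReal.ofReal δ := by
        rw [Finset.sum_const, Finset.card_erase_of_mem (Finset.mem_univ b), Finset.card_univ,
          Fintype.card_fin, nsmul_eq_mul, ← ENNReal.ofReal_natCast,
          ← ENNReal.ofReal_mul (Nat.cast_nonneg _), Nat.cast_sub (by omega)]
        congr 1
        push_cast
        field_simp

/-! ### Asymptotics of `CG` -/

lemma CG_le {l x : ℝ} (hl : l ∈ Set.Ioo (1 / 2 : ℝ) 1) (hx : 0 ≤ x) : CG x ≤ (gG l + x) / l := by
  refine ciInf_le (f := fun l : Set.Ioo (1 / 2 : ℝ) 1 => (gG l + x) / l)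
    ⟨2 - 2 * Real.log 4, ?_⟩ ⟨l, hl⟩
  rintro _ ⟨⟨l, hl⟩, rfl⟩
  refine le_trans ?_ (le_gG_add_div hl hx)
  have h2 : Real.log (1 - l) ≤ 0 :=
    Real.log_nonpos (by linarith [hl.2]) (by linarith [hl.1])
  have := mul_nonneg hx (by linarith [hl.2] : 0 ≤ 2 - l)
  linarith

lemma le_CG_sub_self {x : ℝ} (hx : 0 < x) :
    5 / 2 - 2 * Real.log 4 + 1 / 2 * Real.log (2 * x) ≤ CG x - x := by
  rw [le_sub_iff_add_le]
  refine le_CG fun l hl => le_trans ?_ (le_gG_add_div hl hx.le)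
  have hl1 : 0 < 1 - l := by linarith [hl.2]
  -- Tangent to the logarithm at the minimiser `1 - l = 1 / (2 x)` of `x (1 - l) - log (1 - l) / 2`.
  have h := Real.log_le_sub_one_of_pos (show 0 < 2 * x * (1 - l) by positivity)
  rw [Real.log_mul (by positivity) hl1.ne'] at h
  linarith

lemma CG_sub_self_le {x : ℝ} (hx : 4 ≤ x) :
    CG x - x ≤ 6 + 4 * Real.log (zetaSum (3 / 2)) + Real.log x := by
  have hx0 : 0 < x := by linarith
  have hinv : 1 / x ≤ 1 / 4 := one_div_le_one_div_of_le (by norm_num) hx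
  have hinv0 : 0 < 1 / x := by positivity
  -- Near-optimal test value; `x ≥ 4` gives `2 l ≥ 3 / 2`, which keeps `ζ(2 l)` bounded.
  have hl : 1 - 1 / x ∈ Set.Ioo (1 / 2 : ℝ) 1 := ⟨by linarith, by linarith⟩
  set l := 1 - 1 / x with hldef
  have hl0 : 0 < l := by linarith [hl.1]
  have hlx : l * x = x - 1 := by rw [hldef]; field_simp
  have hlog : Real.log (1 - l) = -Real.log x := by
    rw [hldef, sub_sub_cancel, one_div, Real.log_inv]
  have h1 : 0 ≤ l * Real.log (4 * l) :=
    mul_nonneg hl0.le (Real.log_nonneg (by linarith [hl.1]))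
  have hz : Real.log (zetaSum (2 * l)) ≤ Real.log (zetaSum (3 / 2)) := by
    refine Real.log_le_log ?_ (zetaSum_le_zetaSum (by norm_num) (by linarith))
    linarith [five_div_four_le_zetaSum (s := 2 * l) (by linarith [hl.1]) (by linarith [hl.2])]
  have hz0 : 0 ≤ Real.log (zetaSum (3 / 2)) :=
    Real.log_nonneg (by
      linarith [five_div_four_le_zetaSum (s := 3 / 2) (by norm_num) (by norm_num)])
  have hlogx : 0 ≤ Real.log x := Real.log_nonneg (by linarith)
  have hle := CG_le hl hx0.le
  rw [le_div_iff₀ hl0, gG_eq hl.1, hlog] at hle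
  rw [sub_le_iff_le_add]
  refine le_of_mul_le_mul_right ?_ hl0
  have h2 : (6 + 4 * Real.log (zetaSum (3 / 2)) + Real.log x) * (1 / 2) ≤
      (6 + 4 * Real.log (zetaSum (3 / 2)) + Real.log x) * l :=
    mul_le_mul_of_nonneg_left hl.1.le (by positivity)
  nlinarith [hl.2]

theorem isTheta_CG_sub_self : (fun x => CG x - x) =Θ[Filter.atTop] Real.log := by
  have hz0 : 0 ≤ Real.log (zetaSum (3 / 2)) :=
    Real.log_nonneg (by
      linarith [five_div_four_le_zetaSum (s := 3 / 2) (by norm_num) (by norm_num)])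
  have hlow : ∀ᶠ x in Filter.atTop, 1 / 4 * Real.log x ≤ CG x - x := by
    filter_upwards [Filter.eventually_gt_atTop 0,
      Real.tendsto_log_atTop.eventually_ge_atTop 2] with x hx hlog
    have h := le_CG_sub_self hx
    have h4 : Real.log 4 = 2 * Real.log 2 := by
      rw [show (4 : ℝ) = 2 ^ 2 by norm_num, Real.log_pow]; norm_num
    rw [Real.log_mul (by norm_num) hx.ne'] at h
    linarith [Real.log_two_lt_d9]
  constructor
  · refine Asymptotics.IsBigO.of_bound (7 + 4 * Real.log (zetaSum (3 / 2))) ?_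
    filter_upwards [hlow, Filter.eventually_ge_atTop 4,
      Real.tendsto_log_atTop.eventually_ge_atTop 1] with x hl hx hlog
    rw [Real.norm_of_nonneg (by linarith), Real.norm_of_nonneg (by linarith)]
    have := CG_sub_self_le hx
    nlinarith
  · refine Asymptotics.IsBigO.of_bound 4 ?_
    filter_upwards [hlow, Real.tendsto_log_atTop.eventually_ge_atTop 0] with x hl hlog
    rw [Real.norm_of_nonneg (by linarith), Real.norm_of_nonneg (by linarith)]
    linarith

/-- The error is `O(log x)`, which is `o(x)`, so the coefficient of the logarithm plays no role. -/
theorem isEquivalent_CG : Asymptotics.IsEquivalent Filter.atTop CG (fun x => x + Real.log x) := by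
  have hO : (fun x => CG x - (x + Real.log x)) =O[Filter.atTop] Real.log := by
    refine (isTheta_CG_sub_self.1.sub (Asymptotics.isBigO_refl _ _)).congr_left fun x => ?_
    ring
  have hid : (fun x : ℝ => x) =O[Filter.atTop] fun x => x + Real.log x := by
    refine Asymptotics.IsBigO.of_bound 1 ?_
    filter_upwards [Filter.eventually_ge_atTop 0,
      Real.tendsto_log_atTop.eventually_ge_atTop 0] with x hx hlog
    rw [Real.norm_of_nonneg hx, Real.norm_of_nonneg (by linarith)]
    linarith
  exact hO.trans_isLittleO (Real.isLittleO_log_id_atTop.trans_isBigO hid)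

end UnimodalBandit

theorem lemma1 {K : ℕ} (hK : 2 ≤ K) (v : ℝ≥0) (hv : v ≠ 0) (δ : ℝ) (hδ : δ ∈ Set.Ioo (0 : ℝ) 1)
    (π : UnimodalBandit.SamplingRule K)
    (ρ : ∀ n, UnimodalBandit.History K n → Fin K)
    (hρ : UnimodalBandit.IsLocalRecommendation v ρ) :
    UnimodalBandit.IsDeltaCorrect
      (UnimodalBandit.localGLR v (UnimodalBandit.threshold K δ) π ρ) v δ ∧
    Asymptotics.IsEquivalent Filter.atTop UnimodalBandit.CG (fun x => x + Real.log x) ∧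
    Asymptotics.IsTheta Filter.atTop (fun x => UnimodalBandit.CG x - x) Real.log :=
  ⟨UnimodalBandit.isDeltaCorrect_localGLR hK hv hδ π ρ, UnimodalBandit.isEquivalent_CG,
    UnimodalBandit.isTheta_CG_sub_self⟩
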